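/- For $n\in\{1,2,\dots\}$ and $z=(z_1,\dots,z_n)\in\mathbb R^n$, let $\overline z:=\frac1n(z_1+\dots+z_n)$, $z^{\mathrm g}:=\sqrt[n]{|z_1\cdots z_n|}$, $z_{\max}:=\max(z_1,\dots,z_n)$, and $z_{\min}:=\min(z_1,\dots,z_n)$; for a function $f\colon\mathbb R\to\mathbb R$, let $f(z):=(f(z_1),\dots,f(z_n))$, so that, e.g., $y^2=(y_1^2,\dots,y_n^2)$ and $(y-\overline y)^2=((y_1-\overline y)^2,\dots,(y_n-\overline y)^2)$ for $y\in\mathbb R^n$. Then, for any real numbers $V,E,F$ such that $0<V<\min(E,F)$, $$\sup\Big\{\overline x-x^{\mathrm g}\colon x=y^2,\ y\in[0,\infty)^n,\ n\in\{1,2,\dots\},\ \overline{(y-\overline y)^2}\le V,\ \overline{(y-y_{\min})^2}\le E\Big\}=\max(2V,E)$$ and $$\inf\Big\{\overline x-x^{\mathrm g}\colon x=y^2,\ y\in[0,\infty)^n,\ n\in\{1,2,\dots\},\ \overline{(y-\overline y)^2}\ge V,\ \overline{(y_{\max}-y)^2}\le F\Big\} =\min\Big(2V,\frac{FV}{F-V}\Big).$$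 -/

import Mathlib

noncomputable section

namespace FiniteAG

/-- The arithmetic mean `(z_1 + ⋯ + z_n) / n`. -/
def mean {n : ℕ} (z : Fin n → ℝ) : ℝ := (1 / (n : ℝ)) * ∑ i, z i

/-- The geometric mean: the `n`-th root of `|z_1 ⋯ z_n|`. -/
def geomMean {n : ℕ} (z : Fin n → ℝ) : ℝ := |∏ i, z i| ^ (1 / (n : ℝ))

/-- The largest entry `z_1 ∨ ⋯ ∨ z_n` of a nonempty list. -/
def maxEntry {n : ℕ} [NeZero n] (z : Fin n → ℝ) : ℝ :=
  Finset.univ.sup' Finset.univ_nonempty z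

/-- The smallest entry `z_1 ∧ ⋯ ∧ z_n` of a nonempty list. -/
def minEntry {n : ℕ} [NeZero n] (z : Fin n → ℝ) : ℝ :=
  Finset.univ.inf' Finset.univ_nonempty z

/-- The arithmetic mean of `x` minus its geometric mean, for `x = (y_1 ^ 2, …, y_n ^ 2)`. -/
def gap {n : ℕ} (y : Fin n → ℝ) : ℝ :=
  mean (fun i => y i ^ 2) - geomMean (fun i => y i ^ 2)

/-- All values of the gap over nonnegative vectors `y` of any length `n ≥ 1` with
mean-square deviation at most `V` and mean of `(y - y_min) ^ 2` at most `E`. -/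
def upperGaps (V E : ℝ) : Set ℝ :=
  {d | ∃ (n : ℕ) (_ : NeZero n) (y : Fin n → ℝ), (∀ i, 0 ≤ y i) ∧
    mean (fun i => (y i - mean y) ^ 2) ≤ V ∧
    mean (fun i => (y i - minEntry y) ^ 2) ≤ E ∧
    d = gap y}

/-- All values of the gap over nonnegative vectors `y` of any length `n ≥ 1` with
mean-square deviation at least `V` and mean of `(y_max - y) ^ 2` at most `F`. -/
def lowerGaps (V F : ℝ) : Set ℝ :=
  {d | ∃ (n : ℕ) (_ : NeZero n) (y : Fin n → ℝ), (∀ i, 0 ≤ y i) ∧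
    V ≤ mean (fun i => (y i - mean y) ^ 2) ∧
    mean (fun i => (maxEntry y - y i) ^ 2) ≤ F ∧
    d = gap y}

end FiniteAG

end

/-!
Everything reduces to two-point distributions. Since `log` has positive third derivative, a
quadratic that touches `log` at `c` and meets it at `e` lies below `log` to the right of `e` and above it to
the left of `e` (`exists_quadratic_interpolation_log`). Take `e` to be the smallest entry of `y`,
and `c` the other atom of the two-point distribution that has an atom at `e` and the mean and
variance of `y`. Averaging shows that the geometric mean of `y` is at least that of the two-point
distribution, so the gap is at most the two-point gap; with `e` the largest entry, it is at least
the two-point gap.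

For masses `1 - q` and `q` at `a < c`, the gap lies between `q (c - a)²` and twice the variance
`q (1 - q) (c - a)²` (`twoPointGap_mem`): one comparison is Bernoulli's inequality, the other a
second-order Taylor estimate of a power at `1`. When `a` is the smallest entry of `y`, the quantity
`q (c - a)²` is the mean of `(y - y_min)²`; when `c` is the largest entry, it is `f s / (f - s)`,
with `s` the variance and `f` the mean of `(y_max - y)²`. Vectors with a zero entry have
geometric mean zero and are treated directly.

Both bounds are sharp already for two-valued vectors. An atom at `0` gives the gap `q c²`, and
shifting the two atoms to infinity makes the gap tend to twice the variance
(`tendsto_twoPointGap`). Vectors realize exactly the rational masses `q`, so the value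
`F V / (F - V)`, which belongs to `q = V / F`, is approached through rational `q > V / F`.
-/

namespace FiniteAG

open Set Filter Topology

/-! ### Quadratic interpolation of the logarithm -/

lemma monotoneOn_sub_inv_sub_two_mul_log :
    MonotoneOn (fun x : ℝ => x - x⁻¹ - 2 * Real.log x) (Ioi 0) := by
  have hd : ∀ x ∈ Ioi (0 : ℝ),
      HasDerivAt (fun x : ℝ => x - x⁻¹ - 2 * Real.log x) ((1 - x⁻¹) ^ 2) x := by
    intro x hx
    have hx0 : x ≠ 0 := ne_of_gt hx
    have h := ((hasDerivAt_id x).sub (hasDerivAt_inv hx0)).sub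
      ((Real.hasDerivAt_log hx0).const_mul 2)
    refine h.congr_deriv ?_
    field_simp
    ring
  refine monotoneOn_of_hasDerivWithinAt_nonneg (f' := fun x => (1 - x⁻¹) ^ 2)
    (convex_Ioi 0) (fun x hx => (hd x hx).continuousAt.continuousWithinAt) ?_ ?_
  · intro x hx
    rw [interior_Ioi] at hx
    exact (hd x hx).hasDerivWithinAt
  · intro x _
    positivity

lemma monotoneOn_log_sub_taylor_two :
    MonotoneOn (fun x : ℝ => Real.log x - (x - 1) + (x - 1) ^ 2 / 2) (Ioi 0) := by
  have hd : ∀ x ∈ Ioi (0 : ℝ),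
      HasDerivAt (fun x : ℝ => Real.log x - (x - 1) + (x - 1) ^ 2 / 2) ((x - 1) ^ 2 / x) x := by
    intro x hx
    have hx0 : x ≠ 0 := ne_of_gt hx
    have h1 := (hasDerivAt_id x).sub_const 1
    have h := ((Real.hasDerivAt_log hx0).sub h1).add ((h1.pow 2).div_const 2)
    refine h.congr_deriv ?_
    simp
    field_simp
    ring
  refine monotoneOn_of_hasDerivWithinAt_nonneg (f' := fun x => (x - 1) ^ 2 / x)
    (convex_Ioi 0) (fun x hx => (hd x hx).continuousAt.continuousWithinAt) ?_ ?_
  · intro x hx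
    rw [interior_Ioi] at hx
    exact (hd x hx).hasDerivWithinAt
  · intro x hx
    rw [interior_Ioi] at hx
    have : 0 < x := hx
    positivity

/-- The divided difference of `log` at the nodes `1, 1, x`, for `x ≠ 1`. -/
noncomputable def logDivDiff (x : ℝ) : ℝ := (Real.log x - (x - 1)) / (x - 1) ^ 2

lemma logDivDiff_mul {x : ℝ} (hx : x ≠ 1) :
    logDivDiff x * (x - 1) ^ 2 = Real.log x - (x - 1) := by
  have : x - 1 ≠ 0 := sub_ne_zero.2 hx
  unfold logDivDiff
  field_simp

lemma logDivDiff_le_neg_half {x : ℝ} (hx : 0 < x) (hx1 : x < 1) : logDivDiff x ≤ -(1 / 2) := by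
  have h := monotoneOn_log_sub_taylor_two hx (mem_Ioi.2 one_pos) hx1.le
  simp only [Real.log_one] at h
  have hp : 0 < (x - 1) ^ 2 := by have : x - 1 ≠ 0 := sub_ne_zero.2 hx1.ne; positivity
  rw [logDivDiff, div_le_iff₀ hp]
  linarith

lemma neg_half_le_logDivDiff {x : ℝ} (hx1 : 1 < x) : -(1 / 2) ≤ logDivDiff x := by
  have h := monotoneOn_log_sub_taylor_two (mem_Ioi.2 one_pos) (one_pos.trans hx1 : 0 < x) hx1.le
  simp only [Real.log_one] at h
  have hp : 0 < (x - 1) ^ 2 := by have : x - 1 ≠ 0 := sub_ne_zero.2 hx1.ne'; positivity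
  rw [logDivDiff, le_div_iff₀ hp]
  linarith

lemma monotoneOn_logDivDiff {s : Set ℝ} (hs : Convex ℝ s) (ho : IsOpen s)
    (hpos : ∀ x ∈ s, 0 < x) (hne : ∀ x ∈ s, x ≠ 1) : MonotoneOn logDivDiff s := by
  have hd : ∀ x ∈ s, HasDerivAt logDivDiff
      ((x - x⁻¹ - 2 * Real.log x) * (x - 1) / (x - 1) ^ 4) x := by
    intro x hx
    have hx0 : x ≠ 0 := (hpos x hx).ne'
    have hx1 : x - 1 ≠ 0 := sub_ne_zero.2 (hne x hx)
    have h1 := (hasDerivAt_id x).sub_const 1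
    have h := ((Real.hasDerivAt_log hx0).sub h1).div (h1.pow 2) (pow_ne_zero 2 hx1)
    refine h.congr_deriv ?_
    simp
    field_simp
    ring
  refine monotoneOn_of_hasDerivWithinAt_nonneg
    (f' := fun x => (x - x⁻¹ - 2 * Real.log x) * (x - 1) / (x - 1) ^ 4)
    hs (fun x hx => (hd x hx).continuousAt.continuousWithinAt) ?_ ?_
  · intro x hx
    rw [ho.interior_eq] at hx
    exact (hd x hx).hasDerivWithinAt
  · intro x hx
    rw [ho.interior_eq] at hx
    refine div_nonneg ?_ (by positivity)
    have hm := monotoneOn_sub_inv_sub_two_mul_log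
    rcases lt_or_gt_of_ne (hne x hx) with h | h
    · have := hm (hpos x hx) (mem_Ioi.2 one_pos) h.le
      simp only [Real.log_one, inv_one] at this
      exact mul_nonneg_of_nonpos_of_nonpos (by linarith) (by linarith)
    · have := hm (mem_Ioi.2 one_pos) (hpos x hx) h.le
      simp only [Real.log_one, inv_one] at this
      exact mul_nonneg (by linarith) (by linarith)

lemma logDivDiff_mono {x y : ℝ} (hx : 0 < x) (hxy : x ≤ y) (hx1 : x ≠ 1) (hy1 : y ≠ 1) :
    logDivDiff x ≤ logDivDiff y := by
  rcases lt_or_gt_of_ne hx1 with h | h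
  · rcases lt_or_gt_of_ne hy1 with h' | h'
    · exact monotoneOn_logDivDiff (convex_Ioo 0 1) isOpen_Ioo (fun z hz => hz.1)
        (fun z hz => hz.2.ne) ⟨hx, h⟩ ⟨hx.trans_le hxy, h'⟩ hxy
    · exact (logDivDiff_le_neg_half hx h).trans (neg_half_le_logDivDiff h')
  · exact monotoneOn_logDivDiff (convex_Ioi 1) isOpen_Ioi (fun z hz => one_pos.trans hz)
      (fun z hz => (mem_Ioi.1 hz).ne') h (h.trans_le hxy) hxy

lemma log_eq_of_scale {x c : ℝ} (hx : 0 < x) (hc : 0 < c) (hxc : x ≠ c) :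
    Real.log x = Real.log c + (x - c) / c + logDivDiff (x / c) / c ^ 2 * (x - c) ^ 2 := by
  have h := logDivDiff_mul (x := x / c) (by rwa [ne_eq, div_eq_one_iff_eq hc.ne'])
  rw [Real.log_div hx.ne' hc.ne'] at h
  have h2 : logDivDiff (x / c) / c ^ 2 * (x - c) ^ 2 = logDivDiff (x / c) * (x / c - 1) ^ 2 := by
    field_simp
  have h3 : (x - c) / c = x / c - 1 := by field_simp
  rw [h2, h, h3]
  ring

/-- The quadratic interpolating `log` at the nodes `c, c, e` lies below `log` to the right of `e`
and above it to the left of `e`, because divided differences of `log` at `c, c, x` increase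
with `x` (the third derivative of `log` is positive). -/
lemma exists_quadratic_interpolation_log {c e : ℝ} (hc : 0 < c) (he : 0 < e) (hec : e ≠ c) :
    ∃ B : ℝ, Real.log e = Real.log c + (e - c) / c + B * (e - c) ^ 2 ∧
      (∀ x, e ≤ x → Real.log c + (x - c) / c + B * (x - c) ^ 2 ≤ Real.log x) ∧
      (∀ x, 0 < x → x ≤ e → Real.log x ≤ Real.log c + (x - c) / c + B * (x - c) ^ 2) := by
  refine ⟨logDivDiff (e / c) / c ^ 2, log_eq_of_scale he hc hec, fun x hx => ?_,
    fun x hx0 hx => ?_⟩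
  · rcases eq_or_ne x c with rfl | hxc
    · simp
    · rw [log_eq_of_scale (he.trans_le hx) hc hxc]
      have := logDivDiff_mono (x := e / c) (y := x / c) (by positivity) (by gcongr)
        (by rwa [ne_eq, div_eq_one_iff_eq hc.ne']) (by rwa [ne_eq, div_eq_one_iff_eq hc.ne'])
      gcongr
  · rcases eq_or_ne x c with rfl | hxc
    · simp
    · rw [log_eq_of_scale hx0 hc hxc]
      have := logDivDiff_mono (x := x / c) (y := e / c) (by positivity) (by gcongr)
        (by rwa [ne_eq, div_eq_one_iff_eq hc.ne']) (by rwa [ne_eq, div_eq_one_iff_eq hc.ne'])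
      gcongr

/-! ### Two-point distributions -/

lemma one_add_mul_sub_one_le_rpow {r θ : ℝ} (hr : 0 < r) (hθ : θ ≤ 0) :
    1 + θ * (r - 1) ≤ r ^ θ := by
  rw [Real.rpow_def_of_pos hr]
  have h1 := Real.add_one_le_exp (Real.log r * θ)
  have h2 := mul_le_mul_of_nonpos_left (Real.log_le_sub_one_of_pos hr) hθ
  linarith

lemma rpow_le_one_add_mul_sub_one {r θ : ℝ} (hr : 0 < r) (h0 : 0 ≤ θ) (h1 : θ ≤ 1) :
    r ^ θ ≤ 1 + θ * (r - 1) := by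
  have := rpow_one_add_le_one_add_mul_self (s := r - 1) (by linarith) h0 h1
  rwa [add_sub_cancel] at this

lemma hasDerivAt_rpow_sub_taylor_two (θ : ℝ) {r : ℝ} (hr : 0 < r) :
    HasDerivAt (fun x : ℝ => x ^ (1 + θ) -
      (1 + (1 + θ) * (x - 1) + (1 + θ) * θ / 2 * (x - 1) ^ 2))
      ((1 + θ) * (r ^ θ - (1 + θ * (r - 1)))) r := by
  have h1 := (hasDerivAt_id r).sub_const 1
  have h := (Real.hasDerivAt_rpow_const (p := 1 + θ) (Or.inl hr.ne')).sub
    (((h1.const_mul (1 + θ)).const_add 1).add ((h1.pow 2).const_mul ((1 + θ) * θ / 2)))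
  refine (h.congr_deriv ?_)
  simp
  ring

lemma taylor_two_le_rpow {r θ : ℝ} (hr : 0 < r) (hr1 : r ≤ 1) (h0 : 0 ≤ θ) (h1 : θ ≤ 1) :
    1 + (1 + θ) * (r - 1) + (1 + θ) * θ / 2 * (r - 1) ^ 2 ≤ r ^ (1 + θ) := by
  have hm := antitoneOn_of_hasDerivWithinAt_nonpos (convex_Ioi (0 : ℝ))
    (fun x hx => (hasDerivAt_rpow_sub_taylor_two θ hx).continuousAt.continuousWithinAt)
    (fun x hx => (hasDerivAt_rpow_sub_taylor_two θ
      (by rwa [interior_Ioi] at hx)).hasDerivWithinAt)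
    (fun x hx => by
      rw [interior_Ioi] at hx
      exact mul_nonpos_of_nonneg_of_nonpos (by linarith)
        (sub_nonpos.2 (rpow_le_one_add_mul_sub_one hx h0 h1)))
  have := hm hr (mem_Ioi.2 one_pos) hr1
  simp at this
  linarith

lemma rpow_le_taylor_two {r θ : ℝ} (hr : 0 < r) (hr1 : r ≤ 1) (h0 : -1 ≤ θ) (h1 : θ ≤ 0) :
    r ^ (1 + θ) ≤ 1 + (1 + θ) * (r - 1) + (1 + θ) * θ / 2 * (r - 1) ^ 2 := by
  have hm := monotoneOn_of_hasDerivWithinAt_nonneg (convex_Ioi (0 : ℝ))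
    (fun x hx => (hasDerivAt_rpow_sub_taylor_two θ hx).continuousAt.continuousWithinAt)
    (fun x hx => (hasDerivAt_rpow_sub_taylor_two θ
      (by rwa [interior_Ioi] at hx)).hasDerivWithinAt)
    (fun x hx => by
      rw [interior_Ioi] at hx
      exact mul_nonneg (by linarith)
        (sub_nonneg.2 (one_add_mul_sub_one_le_rpow hx h1)))
  have := hm hr (mem_Ioi.2 one_pos) hr1
  simp at this
  linarith

/-- The gap of the two-point distribution with mass `1 - q` at `a` and mass `q` at `c`. -/
noncomputable def twoPointGap (q a c : ℝ) : ℝ :=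
  q * c ^ 2 + (1 - q) * a ^ 2 - Real.exp (2 * ((1 - q) * Real.log a + q * Real.log c))

/-- Scaling by the upper atom `c` and putting `r = a / c`, `θ = 1 - 2 * q`, the geometric term
of the gap becomes `r ^ (1 + θ)`. -/
lemma twoPointGap_eq {q a c : ℝ} (ha : 0 < a) (hc : 0 < c) :
    twoPointGap q a c =
      c ^ 2 * (q + (1 - q) * (a / c) ^ 2 - (a / c) ^ (1 + (1 - 2 * q))) := by
  have h : Real.exp (2 * ((1 - q) * Real.log a + q * Real.log c)) =
      c ^ 2 * (a / c) ^ (1 + (1 - 2 * q)) := by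
    rw [Real.rpow_def_of_pos (by positivity), Real.log_div ha.ne' hc.ne']
    nth_rewrite 2 [← Real.exp_log hc]
    rw [← Real.exp_nat_mul, ← Real.exp_add]
    congr 1
    push_cast
    ring
  rw [twoPointGap, h]
  field_simp

/-- The gap of a two-point distribution lies between `q (c - a)²` (its value after the atoms are
shifted so that the lower one is `0`) and twice the variance (its limit when the atoms are shifted
to `∞`). The comparison with the former is Bernoulli's inequality, that with the latter a
second-order Taylor estimate; both change direction at `q = 1 / 2`. -/
lemma twoPointGap_mem {q a c : ℝ} (hq0 : 0 ≤ q) (hq1 : q ≤ 1) (ha : 0 < a) (hac : a ≤ c) :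
    min (2 * (q * (1 - q) * (c - a) ^ 2)) (q * (c - a) ^ 2) ≤ twoPointGap q a c ∧
      twoPointGap q a c ≤ max (2 * (q * (1 - q) * (c - a) ^ 2)) (q * (c - a) ^ 2) := by
  have hc : 0 < c := ha.trans_le hac
  set r := a / c with hr_def
  have hr : 0 < r := by positivity
  have hr1 : r ≤ 1 := (div_le_one hc).2 hac
  have har : a = r * c := by rw [hr_def]; field_simp
  have hpow : r ^ (1 + (1 - 2 * q)) = r * r ^ (1 - 2 * q) := by
    rw [Real.rpow_add hr, Real.rpow_one]
  have e1 : 2 * (q * (1 - q) * (c - a) ^ 2) - twoPointGap q a c = c ^ 2 *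
      (r ^ (1 + (1 - 2 * q)) - (1 + (1 + (1 - 2 * q)) * (r - 1) +
        (1 + (1 - 2 * q)) * (1 - 2 * q) / 2 * (r - 1) ^ 2)) := by
    rw [twoPointGap_eq ha hc, ← hr_def, har]
    ring
  have e2 : q * (c - a) ^ 2 - twoPointGap q a c = c ^ 2 * r *
      (r ^ (1 - 2 * q) - (1 + (1 - 2 * q) * (r - 1))) := by
    rw [twoPointGap_eq ha hc, ← hr_def, hpow, har]
    ring
  have hc2 : 0 ≤ c ^ 2 := by positivity
  have hcr : 0 ≤ c ^ 2 * r := by positivity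
  rcases le_total 0 (1 - 2 * q) with h | h
  · have h1 := mul_nonneg hc2
      (sub_nonneg.2 (taylor_two_le_rpow hr hr1 h (by linarith)))
    have h2 := mul_nonpos_of_nonneg_of_nonpos hcr
      (sub_nonpos.2 (rpow_le_one_add_mul_sub_one hr h (by linarith)))
    exact ⟨(min_le_right _ _).trans (by linarith), le_trans (by linarith) (le_max_left _ _)⟩
  · have h1 := mul_nonpos_of_nonneg_of_nonpos hc2
      (sub_nonpos.2 (rpow_le_taylor_two hr hr1 (by linarith) h))
    have h2 := mul_nonneg hcr (sub_nonneg.2 (one_add_mul_sub_one_le_rpow hr h))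
    exact ⟨(min_le_left _ _).trans (by linarith), le_trans (by linarith) (le_max_right _ _)⟩

/-- Shifting both atoms of a two-point distribution to infinity makes the gap converge to twice
the variance. -/
lemma tendsto_twoPointGap (q : ℝ) {d : ℝ} (hd : 0 < d) :
    Tendsto (fun t => twoPointGap q t (t + d)) atTop (𝓝 (2 * (q * (1 - q) * d ^ 2))) := by
  -- With `r = t / (t + d)`, the gap minus its limit is `-d²` times the remainder of the
  -- second-order expansion of `r ^ (2 - 2 q)` at `1`, divided by `(r - 1)²`.
  have key : Tendsto (fun r : ℝ => (r ^ (1 + (1 - 2 * q)) - (1 + (1 + (1 - 2 * q)) * (r - 1) +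
      (1 + (1 - 2 * q)) * (1 - 2 * q) / 2 * (r - 1) ^ 2)) / (r - 1) ^ 2) (𝓝[<] 1) (𝓝 0) := by
    have hpos : ∀ᶠ r : ℝ in 𝓝[<] 1, 0 < r :=
      mem_nhdsWithin_of_mem_nhds (Ioi_mem_nhds one_pos)
    have hlt : ∀ᶠ r : ℝ in 𝓝[<] 1, r < 1 := self_mem_nhdsWithin
    have hcont : ContinuousAt (fun x : ℝ => x ^ (1 + (1 - 2 * q)) - (1 + (1 + (1 - 2 * q)) *
        (x - 1) + (1 + (1 - 2 * q)) * (1 - 2 * q) / 2 * (x - 1) ^ 2)) 1 :=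
      (hasDerivAt_rpow_sub_taylor_two (1 - 2 * q) one_pos).continuousAt
    refine HasDerivAt.lhopital_zero_nhdsLT
      (f' := fun r => (1 + (1 - 2 * q)) * (r ^ (1 - 2 * q) - (1 + (1 - 2 * q) * (r - 1))))
      (g' := fun r => 2 * (r - 1)) ?_ ?_ ?_ ?_ ?_ ?_
    · filter_upwards [hpos] with r hr using hasDerivAt_rpow_sub_taylor_two _ hr
    · refine Eventually.of_forall fun r => ?_
      have := ((hasDerivAt_id r).sub_const 1).pow 2
      exact this.congr_deriv (by simp)
    · filter_upwards [hlt] with r hr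
      intro h
      linarith
    · have := hcont.tendsto
      simp at this
      exact this.mono_left nhdsWithin_le_nhds
    · have : Tendsto (fun r : ℝ => (r - 1) ^ 2) (𝓝 1) (𝓝 ((1 - 1) ^ 2)) :=
        Continuous.tendsto (by fun_prop) 1
      simp at this
      exact this.mono_left nhdsWithin_le_nhds
    · -- The slope of `r ^ (1 - 2 q)` at `1` tends to `1 - 2 q`.
      have hs := (Real.hasDerivAt_rpow_const (x := (1 : ℝ)) (p := 1 - 2 * q)
        (Or.inl one_ne_zero)).tendsto_slope
      have hs' := (((hs.mono_left (nhdsWithin_mono _ (fun x (hx : x < 1) => hx.ne))).sub_const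
        (1 - 2 * q)).const_mul ((1 + (1 - 2 * q)) / 2))
      simp only [Real.one_rpow, mul_one, sub_self, mul_zero] at hs'
      refine hs'.congr' ?_
      filter_upwards [hlt] with r hr
      have : r - 1 ≠ 0 := by linarith
      rw [slope_def_field, Real.one_rpow]
      field_simp
      ring
  have hr : Tendsto (fun t : ℝ => t / (t + d)) atTop (𝓝[<] 1) := by
    refine tendsto_nhdsWithin_iff.2 ⟨?_, ?_⟩
    · have h0 : Tendsto (fun t : ℝ => 1 - d * (t + d)⁻¹) atTop (𝓝 (1 - d * 0)) :=
        ((tendsto_inv_atTop_zero.comp (tendsto_atTop_add_const_right _ d tendsto_id)).const_mul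
          d).const_sub 1
      rw [mul_zero, sub_zero] at h0
      refine h0.congr' ?_
      filter_upwards [eventually_gt_atTop 0] with t ht
      have : t + d ≠ 0 := by positivity
      field_simp
      ring
    · filter_upwards [eventually_gt_atTop 0] with t ht
      exact (div_lt_one (show (0 : ℝ) < t + d by positivity)).2 (by linarith)
  have h := ((key.comp hr).const_mul (d ^ 2)).const_sub (2 * (q * (1 - q) * d ^ 2))
  rw [mul_zero, sub_zero] at h
  refine h.congr' ?_
  filter_upwards [eventually_gt_atTop 0] with t ht
  have htd : t + d ≠ 0 := by positivity
  rw [twoPointGap_eq ht (by positivity), Function.comp_apply]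
  generalize (t / (t + d)) ^ (1 + (1 - 2 * q)) = w
  have h1 : t / (t + d) - 1 = -d / (t + d) := by field_simp; ring
  rw [h1]
  field_simp
  ring

/-! ### Means of vectors -/

section Vectors

variable {n : ℕ}

lemma mean_mono {y z : Fin n → ℝ} (h : ∀ i, y i ≤ z i) : mean y ≤ mean z :=
  mul_le_mul_of_nonneg_left (Finset.sum_le_sum fun i _ => h i) (by positivity)

lemma mean_nonneg {y : Fin n → ℝ} (h : ∀ i, 0 ≤ y i) : 0 ≤ mean y :=
  mul_nonneg (by positivity) (Finset.sum_nonneg fun i _ => h i)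

lemma gap_of_pos {y : Fin n → ℝ} (hy : ∀ i, 0 < y i) :
    gap y = mean (fun i => y i ^ 2) - Real.exp (2 * mean (fun i => Real.log (y i))) := by
  have hp : 0 < ∏ i, y i ^ 2 := Finset.prod_pos fun i _ => pow_pos (hy i) 2
  rw [gap, geomMean, abs_of_pos hp, Real.rpow_def_of_pos hp,
    Real.log_prod fun i _ => (pow_pos (hy i) 2).ne']
  simp only [Real.log_pow, mean, ← Finset.mul_sum]
  congr 2
  push_cast
  ring

variable [NeZero n]

lemma mean_quadratic (y : Fin n → ℝ) (α β γ : ℝ) :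
    mean (fun i => α + β * y i + γ * y i ^ 2) =
      α + β * mean y + γ * mean (fun i => y i ^ 2) := by
  have hn : (n : ℝ) ≠ 0 := Nat.cast_ne_zero.2 (NeZero.ne n)
  simp only [mean, Finset.sum_add_distrib, ← Finset.mul_sum, Finset.sum_const, Finset.card_univ,
    Fintype.card_fin, nsmul_eq_mul]
  field_simp

lemma mean_const (a : ℝ) : mean (fun _ : Fin n => a) = a := by
  have := mean_quadratic (fun _ : Fin n => a) a 0 0
  simpa using this

lemma eq_zero_of_mean_eq_zero {y : Fin n → ℝ} (h : ∀ i, 0 ≤ y i) (h0 : mean y = 0) (i : Fin n) :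
    y i = 0 := by
  have hn : (1 / (n : ℝ)) ≠ 0 := by have := NeZero.ne n; positivity
  have hs := (mul_eq_zero.1 h0).resolve_left hn
  exact (Finset.sum_eq_zero_iff_of_nonneg fun i _ => h i).1 hs i (Finset.mem_univ i)

lemma mean_sq_sub (y : Fin n → ℝ) (a : ℝ) :
    mean (fun i => (y i - a) ^ 2) = mean (fun i => y i ^ 2) - 2 * a * mean y + a ^ 2 := by
  have h : (fun i => (y i - a) ^ 2) = fun i => a ^ 2 + -(2 * a) * y i + 1 * y i ^ 2 := by
    funext i; ring
  rw [h, mean_quadratic]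
  ring

lemma mean_sq_sub' (y : Fin n → ℝ) (a : ℝ) :
    mean (fun i => (a - y i) ^ 2) = mean (fun i => y i ^ 2) - 2 * a * mean y + a ^ 2 := by
  rw [← mean_sq_sub]
  congr 1
  funext i
  ring

lemma gap_of_exists_eq_zero {y : Fin n → ℝ} {i : Fin n} (hi : y i = 0) :
    gap y = mean (fun i => y i ^ 2) := by
  have hn : (1 / (n : ℝ)) ≠ 0 := by have := NeZero.ne n; positivity
  have : ∏ i, y i ^ 2 = 0 := Finset.prod_eq_zero (Finset.mem_univ i) (by simp [hi])
  rw [gap, geomMean, this, abs_zero, Real.zero_rpow hn, sub_zero]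

/-! ### Bounds on the gap -/

/-- A quadratic taking the values of `log` at two atoms has the same mean over `y` as `log` has
over the two-point distribution with the mean and variance of `y`; here the atoms are `e` and
`c`, and the second one carries the mass `q`. -/
lemma mean_quadratic_interpolation (y : Fin n → ℝ) {q c e B : ℝ} (hc : c ≠ 0)
    (hB : Real.log e = Real.log c + (e - c) / c + B * (e - c) ^ 2)
    (h1 : mean y = (1 - q) * e + q * c)
    (h2 : mean (fun i => y i ^ 2) = (1 - q) * e ^ 2 + q * c ^ 2) :
    mean (fun i => Real.log c + (y i - c) / c + B * (y i - c) ^ 2) =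
      (1 - q) * Real.log e + q * Real.log c := by
  have h : (fun i => Real.log c + (y i - c) / c + B * (y i - c) ^ 2) = fun i =>
      (Real.log c - 1 + B * c ^ 2) + (1 / c - 2 * B * c) * y i + B * y i ^ 2 := by
    funext i; field_simp; ring
  rw [h, mean_quadratic, h1, h2, hB]
  field_simp
  ring

lemma gap_le_twoPointGap {y : Fin n → ℝ} {q a c : ℝ} (ha : 0 < a) (hac : a < c)
    (hy : ∀ i, a ≤ y i) (h1 : mean y = (1 - q) * a + q * c)
    (h2 : mean (fun i => y i ^ 2) = (1 - q) * a ^ 2 + q * c ^ 2) :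
    gap y ≤ twoPointGap q a c := by
  obtain ⟨B, hB, hle, -⟩ := exists_quadratic_interpolation_log (ha.trans hac) ha hac.ne
  have h := mean_mono fun i => hle (y i) (hy i)
  rw [mean_quadratic_interpolation y (ha.trans hac).ne' hB h1 h2] at h
  rw [gap_of_pos fun i => ha.trans_le (hy i), twoPointGap, h2]
  have := Real.exp_le_exp.2 (mul_le_mul_of_nonneg_left h zero_le_two)
  linarith

lemma twoPointGap_le_gap {y : Fin n → ℝ} {q c b : ℝ} (hc : 0 < c) (hcb : c < b)
    (hpos : ∀ i, 0 < y i) (hy : ∀ i, y i ≤ b) (h1 : mean y = (1 - q) * c + q * b)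
    (h2 : mean (fun i => y i ^ 2) = (1 - q) * c ^ 2 + q * b ^ 2) :
    twoPointGap q c b ≤ gap y := by
  obtain ⟨B, hB, -, hle⟩ := exists_quadratic_interpolation_log hc (hc.trans hcb) hcb.ne'
  have h := mean_mono fun i => hle (y i) (hpos i) (hy i)
  rw [mean_quadratic_interpolation y (q := 1 - q) hc.ne' hB (by rw [h1]; ring)
    (by rw [h2]; ring)] at h
  rw [gap_of_pos hpos, twoPointGap, h2]
  have := Real.exp_le_exp.2 (mul_le_mul_of_nonneg_left h zero_le_two)
  have e : 2 * ((1 - q) * Real.log c + q * Real.log b) =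
    2 * ((1 - (1 - q)) * Real.log b + (1 - q) * Real.log c) := by ring
  rw [e]
  linarith

/-- The gap is at most the larger of twice the variance and the mean of `(y - a)²`, where `a` is
an attained lower bound. -/
lemma gap_le_max {y : Fin n → ℝ} {a : ℝ} (ha0 : 0 ≤ a) (hy : ∀ i, a ≤ y i) (hmem : ∃ i, y i = a) :
    gap y ≤ max (2 * mean (fun i => (y i - mean y) ^ 2)) (mean (fun i => (y i - a) ^ 2)) := by
  rcases ha0.eq_or_lt with rfl | ha
  · obtain ⟨i, hi⟩ := hmem
    rw [gap_of_exists_eq_zero hi]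
    simp
  set m := mean y with hm
  set M := mean (fun i => y i ^ 2) with hM
  have hs : mean (fun i => (y i - m) ^ 2) = M - m ^ 2 := by
    rw [mean_sq_sub, ← hm, ← hM]; ring
  have he : mean (fun i => (y i - a) ^ 2) = M - 2 * a * m + a ^ 2 := mean_sq_sub y a
  have hs0 : 0 ≤ M - m ^ 2 := hs ▸ mean_nonneg fun i => sq_nonneg _
  have ham : a ≤ m := by simpa [mean_const] using mean_mono hy
  rcases ham.eq_or_lt with hame | ham
  · -- All entries equal `a`, so the gap vanishes.
    have h0 : ∀ i, y i = a := fun i => sub_eq_zero.1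
      (eq_zero_of_mean_eq_zero (y := fun i => y i - a) (fun i => sub_nonneg.2 (hy i)) (by
        have : (fun i => y i - a) = fun i => -a + 1 * y i + 0 * y i ^ 2 := by funext i; ring
        rw [this, mean_quadratic, ← hm, ← hame]; ring) i)
    have hya : y = fun _ => a := funext h0
    have hg : gap y = 0 := by
      rw [gap_of_pos fun i => ha.trans_le (hy i), hya, mean_const, mean_const, mul_comm, mul_two,
        Real.exp_add, Real.exp_log ha]
      ring
    rw [hg, hs]
    exact le_max_of_le_left (by linarith)
  · set k := m - a with hk
    have hk0 : 0 < k := sub_pos.2 ham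
    set s := M - m ^ 2 with hsd
    have hmk : m = a + k := by rw [hk]; ring
    have hMs : M = s + m ^ 2 := by rw [hsd]; ring
    have hD : 0 < s + k ^ 2 := by positivity
    -- The two-point distribution with lower atom `a` and the mean and variance of `y`.
    have hcd : a + (s + k ^ 2) / k - a = (s + k ^ 2) / k := by ring
    have hac : a < a + (s + k ^ 2) / k := by have : 0 < (s + k ^ 2) / k := by positivity
                                             linarith
    have hq0 : 0 ≤ k ^ 2 / (s + k ^ 2) := by positivity
    have hq1 : k ^ 2 / (s + k ^ 2) ≤ 1 := (div_le_one hD).2 (by linarith)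
    have h1 := gap_le_twoPointGap (y := y) (q := k ^ 2 / (s + k ^ 2)) ha hac hy
      (by rw [← hm, hmk]; field_simp; ring)
      (by rw [← hM, hMs, hmk]; field_simp; ring)
    refine (h1.trans (twoPointGap_mem hq0 hq1 ha hac.le).2).trans (le_of_eq ?_)
    rw [hs, he, hcd]
    congr 1
    · field_simp
      ring
    · rw [hMs, hmk]
      field_simp
      ring

/-- With `s` the variance and `f` the mean of `(b - y)²`, the gap is at least the smaller of `2 s`
and `f s / (f - s)`; here `b` is an upper bound, and `f - s = (b - mean y)²`. -/
lemma min_le_gap {y : Fin n → ℝ} {b : ℝ} (hy0 : ∀ i, 0 ≤ y i) (hy : ∀ i, y i ≤ b)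
    (hs : 0 < mean (fun i => (y i - mean y) ^ 2)) :
    mean (fun i => (y i - mean y) ^ 2) < mean (fun i => (b - y i) ^ 2) ∧
    min (2 * mean (fun i => (y i - mean y) ^ 2))
      (mean (fun i => (b - y i) ^ 2) * mean (fun i => (y i - mean y) ^ 2) /
        (mean (fun i => (b - y i) ^ 2) - mean (fun i => (y i - mean y) ^ 2))) ≤ gap y := by
  set m := mean y with hm
  set M := mean (fun i => y i ^ 2) with hM
  have hs' : mean (fun i => (y i - m) ^ 2) = M - m ^ 2 := by
    rw [mean_sq_sub, ← hm, ← hM]; ring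
  rw [hs', mean_sq_sub' y b, ← hm, ← hM]
  rw [hs'] at hs
  have hmb : m ≤ b := by simpa [mean_const] using mean_mono hy
  have hb0 : 0 ≤ b := (mean_nonneg hy0).trans hmb
  have hmul : mean (fun i => y i * (b - y i)) = b * m - M := by
    have : (fun i => y i * (b - y i)) = fun i => 0 + b * y i + (-1) * y i ^ 2 := by
      funext i; ring
    rw [this, mean_quadratic, ← hm, ← hM]; ring
  have hmul0 : 0 ≤ b * m - M :=
    hmul ▸ mean_nonneg fun i => mul_nonneg (hy0 i) (sub_nonneg.2 (hy i))
  have hmb : m < b := by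
    refine lt_of_le_of_ne hmb fun h => ?_
    rw [← h] at hmul0
    nlinarith
  set k := b - m with hk
  have hk0 : 0 < k := sub_pos.2 hmb
  set s := M - m ^ 2 with hsd
  have hbk : b = m + k := by rw [hk]; ring
  have hMs : M = s + m ^ 2 := by rw [hsd]; ring
  have hf : M - 2 * b * m + b ^ 2 = s + k ^ 2 := by rw [hMs, hbk]; ring
  rw [hf]
  have hD : 0 < s + k ^ 2 := by positivity
  refine ⟨by nlinarith, ?_⟩
  rw [add_sub_cancel_left]
  have hmk : s ≤ m * k := by rw [hk, hsd]; linarith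
  by_cases hz : ∃ i, y i = 0
  · obtain ⟨i, hi⟩ := hz
    rw [gap_of_exists_eq_zero hi, ← hM, hMs]
    refine (min_le_right _ _).trans ?_
    rw [div_le_iff₀ (by positivity)]
    nlinarith [mul_self_le_mul_self hs.le hmk]
  · have hpos : ∀ i, 0 < y i := fun i => (hy0 i).lt_of_ne fun h => hz ⟨i, h.symm⟩
    -- The lower atom `m - s / k` is positive, since `mean (y (b - y)) > 0`.
    have hmk' : s < m * k := by
      refine lt_of_le_of_ne hmk fun h => ?_
      have h0 : mean (fun i => y i * (b - y i)) = 0 := by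
        rw [hmul, hMs, hbk]; linarith
      have hyb : y = fun _ => b := funext fun i => by
        have := eq_zero_of_mean_eq_zero
          (fun i => mul_nonneg (hy0 i) (sub_nonneg.2 (hy i))) h0 i
        have := (mul_eq_zero.1 this).resolve_left (hpos i).ne'
        linarith
      rw [hm, hyb, mean_const] at hmb
      exact hmb.false
    have hc : 0 < m - s / k := by
      rw [sub_pos, div_lt_iff₀ hk0]
      exact hmk'
    have hcb : m - s / k < b := by have : 0 < s / k := by positivity
                                   linarith
    have hcd : b - (m - s / k) = (s + k ^ 2) / k := by rw [hbk]; field_simp; ring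
    have hq0 : 0 ≤ s / (s + k ^ 2) := by positivity
    have hq1 : s / (s + k ^ 2) ≤ 1 := (div_le_one hD).2 (by nlinarith)
    have h1 := twoPointGap_le_gap (y := y) (q := s / (s + k ^ 2)) hc hcb hpos hy
      (by rw [← hm, hbk]; field_simp; ring)
      (by rw [← hM, hMs, hbk]; field_simp; ring)
    refine le_trans (le_of_eq ?_) ((twoPointGap_mem hq0 hq1 hc hcb.le).1.trans h1)
    rw [hcd]
    congr 1
    · field_simp
      ring
    · field_simp

end Vectors

/-! ### Two-valued vectors and sharpness -/

/-- Every two-point distribution with a rational mass `q` at the upper atom is the empirical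
distribution of some vector. -/
lemma exists_two_valued (q : ℚ) (hq0 : 0 < q) (hq1 : q < 1) (a c : ℝ) :
    ∃ (n : ℕ) (_ : NeZero n) (y : Fin n → ℝ), (∀ i, y i = a ∨ y i = c) ∧ (∃ i, y i = a) ∧
      (∃ i, y i = c) ∧
      ∀ φ : ℝ → ℝ, mean (fun i => φ (y i)) = (1 - (q : ℝ)) * φ a + q * φ c := by
  obtain ⟨k, hk⟩ := Int.eq_ofNat_of_zero_le (Rat.num_nonneg.2 hq0.le)
  have hden : q.den ≠ 0 := q.den_nz
  have hqk : q = (k : ℚ) / q.den := by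
    conv_lhs => rw [← Rat.num_div_den q, hk]
    simp
  have hdpos : (0 : ℚ) < q.den := by exact_mod_cast q.den_pos
  have hk0 : 0 < k := by
    rw [hqk] at hq0
    have := (div_pos_iff_of_pos_right hdpos).1 hq0
    exact_mod_cast this
  have hkn : k < q.den := by
    rw [hqk, div_lt_one hdpos] at hq1
    exact_mod_cast hq1
  have hqr : (q : ℝ) = (k : ℝ) / (q.den : ℝ) := by
    have := congrArg (fun x : ℚ => (x : ℝ)) hqk
    simpa using this
  refine ⟨q.den, ⟨hden⟩, fun i => if (i : ℕ) < k then c else a, fun i => ?_,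
    ⟨⟨k, hkn⟩, by simp⟩, ⟨⟨0, q.den_pos⟩, by simp [hk0]⟩, fun φ => ?_⟩
  · by_cases h : (i : ℕ) < k <;> simp [h]
  · have hsum : ∑ i : Fin q.den, φ (if (i : ℕ) < k then c else a) =
        k * φ c + (q.den - k) * φ a := by
      rw [Fin.sum_univ_eq_sum_range (fun i => φ (if i < k then c else a)) q.den,
        ← Finset.sum_range_add_sum_Ico _ hkn.le,
        Finset.sum_congr rfl (g := fun _ => φ c)
          (fun i hi => by rw [if_pos (Finset.mem_range.1 hi)]),
        Finset.sum_congr (s₁ := Finset.Ico k q.den) rfl (g := fun _ => φ a)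
          (fun i hi => by rw [if_neg (not_lt.2 (Finset.mem_Ico.1 hi).1)])]
      simp [Nat.cast_sub hkn.le]
    have hd : (q.den : ℝ) ≠ 0 := Nat.cast_ne_zero.2 hden
    rw [mean, hsum, hqr]
    field_simp
    ring

lemma exists_two_valued_gap (q : ℚ) (hq0 : 0 < q) (hq1 : q < 1) {a c : ℝ} (ha : 0 ≤ a)
    (hac : a ≤ c) :
    ∃ (n : ℕ) (_ : NeZero n) (y : Fin n → ℝ), (∀ i, 0 ≤ y i) ∧
      mean (fun i => (y i - mean y) ^ 2) = q * (1 - q) * (c - a) ^ 2 ∧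
      mean (fun i => (y i - minEntry y) ^ 2) = q * (c - a) ^ 2 ∧
      mean (fun i => (maxEntry y - y i) ^ 2) = (1 - q) * (c - a) ^ 2 ∧
      (a = 0 → gap y = q * c ^ 2) ∧ (0 < a → gap y = twoPointGap q a c) := by
  obtain ⟨n, hn, y, hy, ⟨i, hi⟩, ⟨j, hj⟩, hφ⟩ := exists_two_valued q hq0 hq1 a c
  have hay : ∀ l, a ≤ y l := fun l => by rcases hy l with h | h <;> rw [h]; exact hac
  have hyc : ∀ l, y l ≤ c := fun l => by rcases hy l with h | h <;> rw [h]; exact hac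
  have hmin : minEntry y = a :=
    le_antisymm ((Finset.inf'_le _ (Finset.mem_univ i)).trans_eq hi)
      (Finset.le_inf' _ _ fun l _ => hay l)
  have hmax : maxEntry y = c :=
    le_antisymm (Finset.sup'_le _ _ fun l _ => hyc l)
      (hj.symm.trans_le (Finset.le_sup' _ (Finset.mem_univ j)))
  have hm : mean y = (1 - q) * a + q * c := hφ id
  refine ⟨n, hn, y, fun l => ha.trans (hay l), ?_, ?_, ?_, fun h => ?_, fun h => ?_⟩
  · rw [hm, hφ fun x => (x - ((1 - q) * a + q * c)) ^ 2]
    ring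
  · rw [hmin, hφ fun x => (x - a) ^ 2]
    ring
  · rw [hmax, hφ fun x => (c - x) ^ 2]
    ring
  · rw [gap_of_exists_eq_zero (hi.trans h), hφ fun x => x ^ 2, h]
    ring
  · rw [gap_of_pos fun l => h.trans_le (hay l), hφ fun x => x ^ 2, hφ Real.log, twoPointGap]
    ring

lemma twoPointGap_mem_upperGaps {V E d t : ℝ} {q : ℚ} (hq0 : 0 < q) (hq1 : q < 1) (hd : 0 ≤ d)
    (ht : 0 < t) (hV : q * (1 - q) * d ^ 2 ≤ V) (hE : q * d ^ 2 ≤ E) :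
    twoPointGap q t (t + d) ∈ upperGaps V E := by
  obtain ⟨n, hn, y, hy, h1, h2, -, -, h5⟩ :=
    exists_two_valued_gap q hq0 hq1 ht.le (le_add_of_nonneg_right hd)
  rw [add_sub_cancel_left] at h1 h2
  exact ⟨n, hn, y, hy, h1.trans_le hV, h2.trans_le hE, (h5 ht).symm⟩

lemma twoPointGap_mem_lowerGaps {V F d t : ℝ} {q : ℚ} (hq0 : 0 < q) (hq1 : q < 1) (hd : 0 ≤ d)
    (ht : 0 < t) (hV : V ≤ q * (1 - q) * d ^ 2) (hF : (1 - q) * d ^ 2 ≤ F) :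
    twoPointGap q t (t + d) ∈ lowerGaps V F := by
  obtain ⟨n, hn, y, hy, h1, -, h3, -, h5⟩ :=
    exists_two_valued_gap q hq0 hq1 ht.le (le_add_of_nonneg_right hd)
  rw [add_sub_cancel_left] at h1 h3
  exact ⟨n, hn, y, hy, hV.trans_eq h1.symm, h3.trans_le hF, (h5 ht).symm⟩

lemma mem_upperGaps_of_zero_atom {V E d : ℝ} {q : ℚ} (hq0 : 0 < q) (hq1 : q < 1) (hd : 0 ≤ d)
    (hV : q * (1 - q) * d ^ 2 ≤ V) (hE : q * d ^ 2 ≤ E) : q * d ^ 2 ∈ upperGaps V E := by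
  obtain ⟨n, hn, y, hy, h1, h2, -, h4, -⟩ := exists_two_valued_gap q hq0 hq1 le_rfl hd
  rw [sub_zero] at h1 h2
  exact ⟨n, hn, y, hy, h1.trans_le hV, h2.trans_le hE, (h4 rfl).symm⟩

lemma mem_lowerGaps_of_zero_atom {V F d : ℝ} {q : ℚ} (hq0 : 0 < q) (hq1 : q < 1) (hd : 0 ≤ d)
    (hV : V ≤ q * (1 - q) * d ^ 2) (hF : (1 - q) * d ^ 2 ≤ F) : q * d ^ 2 ∈ lowerGaps V F := by
  obtain ⟨n, hn, y, hy, h1, -, h3, h4, -⟩ := exists_two_valued_gap q hq0 hq1 le_rfl hd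
  rw [sub_zero] at h1 h3
  exact ⟨n, hn, y, hy, hV.trans_eq h1.symm, h3.trans_le hF, (h4 rfl).symm⟩

lemma isLUB_upperGaps {V E : ℝ} (hV : 0 < V) (hVE : V < E) :
    IsLUB (upperGaps V E) (max (2 * V) E) := by
  have hE : 0 < E := hV.trans hVE
  refine ⟨?_, fun M hM => max_le ?_ ?_⟩
  · rintro _ ⟨n, hn, y, hy, hs, he, rfl⟩
    have hmin : ∀ i, minEntry y ≤ y i := fun i => Finset.inf'_le _ (Finset.mem_univ i)
    have hmem : ∃ i, y i = minEntry y := by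
      obtain ⟨i, -, hi⟩ := Finset.exists_mem_eq_inf' (s := Finset.univ) Finset.univ_nonempty y
      exact ⟨i, hi.symm⟩
    have h0 : 0 ≤ minEntry y := Finset.le_inf' _ _ fun i _ => hy i
    exact (gap_le_max h0 hmin hmem).trans (max_le_max (by linarith) he)
  · -- Two-point distributions of variance `V` whose atoms are shifted to infinity.
    obtain ⟨q, hq0, hq⟩ := exists_rat_btwn (show (0 : ℝ) < 1 - V / E by
      rw [sub_pos, div_lt_one hE]; exact hVE)
    have hVE0 : 0 < V / E := by positivity
    have hq1 : (q : ℝ) < 1 := by linarith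
    have hp : 0 < 1 - (q : ℝ) := by linarith
    set d := Real.sqrt (V / (q * (1 - q))) with hd
    have hd2 : d ^ 2 = V / (q * (1 - q)) := Real.sq_sqrt (by positivity)
    have hd0 : 0 < d := Real.sqrt_pos.2 (by positivity)
    have hVd : q * (1 - q) * d ^ 2 = V := by rw [hd2]; field_simp
    have hEd : q * d ^ 2 ≤ E := by
      have : q * d ^ 2 = V / (1 - q) := by rw [hd2]; field_simp
      rw [this, div_le_iff₀ hp, ← div_le_iff₀' hE]
      linarith
    have hlim := tendsto_twoPointGap q hd0
    rw [hVd] at hlim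
    refine le_of_tendsto hlim ?_
    filter_upwards [eventually_gt_atTop 0] with t ht
    exact hM (twoPointGap_mem_upperGaps (by exact_mod_cast hq0) (by exact_mod_cast hq1) hd0.le ht
      hVd.le hEd)
  · -- A small mass at `0` attains the value `E`.
    obtain ⟨q, hq, hq1⟩ := exists_rat_btwn (show 1 - V / E < (1 : ℝ) by
      have : 0 < V / E := by positivity
      linarith)
    have hVE1 : V / E < 1 := (div_lt_one hE).2 hVE
    have hq0 : 0 < (q : ℝ) := by linarith
    have hd2 : Real.sqrt (E / q) ^ 2 = E / q := Real.sq_sqrt (by positivity)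
    have hEd : q * Real.sqrt (E / q) ^ 2 = E := by rw [hd2]; field_simp
    have hVd : q * (1 - q) * Real.sqrt (E / q) ^ 2 ≤ V := by
      have : q * (1 - q) * Real.sqrt (E / q) ^ 2 = (1 - q) * E := by rw [hd2]; field_simp
      rw [this, ← le_div_iff₀ hE]
      linarith
    have := hM (mem_upperGaps_of_zero_atom (by exact_mod_cast hq0) (by exact_mod_cast hq1)
      (Real.sqrt_nonneg _) hVd hEd.le)
    rwa [hEd] at this

lemma isGLB_lowerGaps {V F : ℝ} (hV : 0 < V) (hVF : V < F) :
    IsGLB (lowerGaps V F) (min (2 * V) (F * V / (F - V))) := by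
  have hF : 0 < F := hV.trans hVF
  have hFV : 0 < F - V := sub_pos.2 hVF
  refine ⟨?_, fun M hM => le_min ?_ ?_⟩
  · rintro _ ⟨n, hn, y, hy, hs, hf, rfl⟩
    have hmax : ∀ i, y i ≤ maxEntry y := fun i => Finset.le_sup' _ (Finset.mem_univ i)
    obtain ⟨hlt, hle⟩ := min_le_gap hy hmax (hV.trans_le hs)
    refine le_trans (min_le_min (by linarith) ?_) hle
    -- `f s / (f - s)` increases in `s` and decreases in `f`.
    set s := mean (fun i => (y i - mean y) ^ 2)
    set f := mean (fun i => (maxEntry y - y i) ^ 2)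
    have hs0 : 0 < s := hV.trans_le hs
    rw [div_le_div_iff₀ hFV (sub_pos.2 hlt)]
    have h1 : V * s * f ≤ V * s * F := mul_le_mul_of_nonneg_left hf (by positivity)
    have h2 : F * f * V ≤ F * f * s :=
      mul_le_mul_of_nonneg_left hs (mul_nonneg hF.le (hs0.trans hlt).le)
    linarith
  · -- Two-point distributions of variance `V` whose atoms are shifted to infinity.
    obtain ⟨q, hq, hq1⟩ := exists_rat_btwn ((div_lt_one hF).2 hVF)
    have hq0 : 0 < (q : ℝ) := (show 0 < V / F by positivity).trans hq
    have hp : 0 < 1 - (q : ℝ) := by linarith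
    set d := Real.sqrt (V / (q * (1 - q))) with hd
    have hd2 : d ^ 2 = V / (q * (1 - q)) := Real.sq_sqrt (by positivity)
    have hd0 : 0 < d := Real.sqrt_pos.2 (by positivity)
    have hVd : q * (1 - q) * d ^ 2 = V := by rw [hd2]; field_simp
    have hFd : (1 - q) * d ^ 2 ≤ F := by
      have : (1 - q) * d ^ 2 = V / q := by rw [hd2]; field_simp
      rw [this, div_le_iff₀ hq0, ← div_le_iff₀' hF]
      exact hq.le
    have hlim := tendsto_twoPointGap q hd0
    rw [hVd] at hlim
    refine ge_of_tendsto hlim ?_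
    filter_upwards [eventually_gt_atTop 0] with t ht
    exact hM (twoPointGap_mem_lowerGaps (by exact_mod_cast hq0) (by exact_mod_cast hq1) hd0.le ht
      hVd.ge hFd)
  · -- Mass `1 - q` at `0`, with `q` decreasing to `V / F`, gives the values `q F / (1 - q)`.
    by_contra! hlt
    have hM0 : 0 < M := lt_trans (by positivity) hlt
    rw [div_lt_iff₀ hFV] at hlt
    obtain ⟨q, hq, hqM⟩ := exists_rat_btwn (show V / F < M / (M + F) by
      rw [div_lt_div_iff₀ hF (by positivity)]
      linarith)
    have hq0 : 0 < (q : ℝ) := (show 0 < V / F by positivity).trans hq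
    have hq1 : (q : ℝ) < 1 := hqM.trans ((div_lt_one (by positivity)).2 (by linarith))
    have hp : 0 < 1 - (q : ℝ) := by linarith
    have hd2 : Real.sqrt (F / (1 - q)) ^ 2 = F / (1 - q) := Real.sq_sqrt (by positivity)
    have hVd : V ≤ q * (1 - q) * Real.sqrt (F / (1 - q)) ^ 2 := by
      have : q * (1 - q) * Real.sqrt (F / (1 - q)) ^ 2 = q * F := by rw [hd2]; field_simp
      rw [this, ← div_le_iff₀ hF]
      exact hq.le
    have hFd : (1 - q) * Real.sqrt (F / (1 - q)) ^ 2 ≤ F := by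
      rw [hd2, mul_div_cancel₀ _ hp.ne']
    have h := hM (mem_lowerGaps_of_zero_atom (by exact_mod_cast hq0) (by exact_mod_cast hq1)
      (Real.sqrt_nonneg _) hVd hFd)
    rw [hd2, ← mul_div_assoc, le_div_iff₀ hp] at h
    rw [lt_div_iff₀ (by positivity)] at hqM
    linarith

end FiniteAG

theorem corollary1 (V E F : ℝ) (hV : 0 < V) (hVEF : V < min E F) :
    IsLUB (FiniteAG.upperGaps V E) (max (2 * V) E) ∧
      IsGLB (FiniteAG.lowerGaps V F) (min (2 * V) (F * V / (F - V))) :=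
  ⟨FiniteAG.isLUB_upperGaps hV (hVEF.trans_le (min_le_left _ _)),
    FiniteAG.isGLB_lowerGaps hV (hVEF.trans_le (min_le_right _ _))⟩
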